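/- Let $\mathbb{N}=\{1,2,3,\dots\}$ and let $\beta\mathbb{N}$ be the space of ultrafilters on $\mathbb{N}$ with its usual (Stone) topology, each $n\in\mathbb{N}$ being identified with the principal ultrafilter it generates. For $p,q\in\beta\mathbb{N}$ let $p\odot q$ and $E_1(p,q)$ be the ultrafilters given, for $A\subseteq\mathbb{N}$, by \[A\in p\odot q\iff\{n\in\mathbb{N}\mid\{m\in\mathbb{N}\mid n\cdot m\in A\}\in q\}\in p,\] \[A\in E_1(p,q)\iff\{n\in\mathbb{N}\mid\{m\in\mathbb{N}\mid n^m\in A\}\in q\}\in p.\] Let $K(\beta\mathbb{N},\odot)$ be the smallest two-sided ideal of the semigroup $(\beta\mathbb{N},\odot)$, let $\overline{K(\beta\mathbb{N},\odot)}$ be its topological closure in $\beta\mathbb{N}$, and let \[\mathrm{ESW}=\{p\in\beta\mathbb{N}\mid \forall A\in p\ \exists x,y\in A\ \text{such that}\ x^{y}\in A\}\] be the set of exponential Schur witnesses. Let $q\in\overline{K(\beta\mathbb{N},\odot)}$. Then for all $p\in\beta\mathbb{N}\setminus\{1\}$ we have $E_1(p,q)\in\mathrm{ESW}$. -/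

import Mathlib

/-- A two-sided ideal of a semigroup: a nonempty subset `I` that absorbs multiplication by
arbitrary elements on the left and on the right. -/
def IsTwoSidedIdeal {S : Type*} [Semigroup S] (I : Set S) : Prop :=
  I.Nonempty ∧ ∀ x ∈ I, ∀ s : S, s * x ∈ I ∧ x * s ∈ I

/-- The intersection of all two-sided ideals of a semigroup. Whenever the semigroup has a smallest
two-sided ideal `K(S)`, as every compact right topological semigroup does, this is `K(S)`. -/
def smallestIdeal (S : Type*) [Semigroup S] : Set S :=
  ⋂₀ {I : Set S | IsTwoSidedIdeal I}

/-- `β ℕ`, the space of ultrafilters on the positive integers, with its usual (Stone) topology. -/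
abbrev BetaN : Type := Ultrafilter ℕ+

/-- The semigroup `(β ℕ, ⊙)`. -/
instance BetaN.instSemigroup : Semigroup BetaN := Ultrafilter.semigroup

/-- `A ∈ p ⊙ q` iff `{n | {m | n * m ∈ A} ∈ q} ∈ p`. -/
theorem BetaN.mem_mul (p q : BetaN) (A : Set ℕ+) :
    A ∈ p * q ↔ {n : ℕ+ | {m : ℕ+ | n * m ∈ A} ∈ q} ∈ p :=
  Iff.rfl

/-- `K(β ℕ, ⊙)` is the smallest two-sided ideal of `(β ℕ, ⊙)`: it is a two-sided ideal (in
particular it is nonempty), and it is contained in every other one. -/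
theorem isLeast_smallestIdeal_betaN :
    IsLeast {I : Set BetaN | IsTwoSidedIdeal I} (smallestIdeal BetaN) := by
  refine ⟨⟨?_, fun x hx s => ⟨fun I hI => (hI.2 x (hx I hI) s).1,
    fun I hI => (hI.2 x (hx I hI) s).2⟩⟩, fun I hI => Set.sInter_subset_of_mem hI⟩
  obtain ⟨M, hM⟩ : ∃ M, Minimal
      (· ∈ {L : Set BetaN | IsClosed L ∧ L.Nonempty ∧ ∀ x ∈ L, ∀ s : BetaN, s * x ∈ L}) M := by
    refine zorn_superset _ fun c hcs hc => ?_
    rcases c.eq_empty_or_nonempty with rfl | hne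
    · exact ⟨Set.univ, ⟨isClosed_univ, ⟨pure 1, trivial⟩, fun _ _ _ => trivial⟩, by simp⟩
    · refine ⟨⋂₀ c, ⟨isClosed_sInter fun t ht => (hcs ht).1, ?_, fun x hx s t ht =>
        (hcs ht).2.2 x (hx t ht) s⟩, fun t ht => Set.sInter_subset_of_mem ht⟩
      have := hne.to_subtype
      rw [Set.sInter_eq_iInter]
      exact IsCompact.nonempty_iInter_of_directed_nonempty_isCompact_isClosed _
        (DirectedOn.directed_val (IsChain.directedOn hc.symm)) (fun t => (hcs t.2).2.1)
        (fun t => (hcs t.2).1.isCompact) (fun t => (hcs t.2).1)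
  obtain ⟨y, hy⟩ := hM.prop.2.1
  refine ⟨y, fun I hI => ?_⟩
  obtain ⟨i, hi⟩ := hI.1
  have hsub : M ⊆ Set.range (fun s : BetaN => s * (i * y)) := by
    refine hM.le_of_le ⟨?_, Set.range_nonempty _, ?_⟩ ?_
    · exact (isCompact_range (Ultrafilter.continuous_mul_left (i * y))).isClosed
    · rintro _ ⟨s, rfl⟩ t
      exact ⟨t * s, mul_assoc _ _ _⟩
    · rintro _ ⟨s, rfl⟩
      exact hM.prop.2.2 _ (hM.prop.2.2 y hy i) s
  obtain ⟨s, hs⟩ := hsub hy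
  rw [← hs]
  exact (hI.2 _ (hI.2 i hi y).2 s).1

/-- The exponentiation `E₁` of ultrafilters: the image of the tensor product `p ⊗ q` under
`(n, m) ↦ n ^ m`. -/
def E₁ (p q : BetaN) : BetaN :=
  p.bind fun n => q.map fun m => n ^ (m : ℕ)

/-- `A ∈ E₁(p, q)` iff `{n | {m | n ^ m ∈ A} ∈ q} ∈ p`. -/
theorem mem_E₁ (p q : BetaN) (A : Set ℕ+) :
    A ∈ E₁ p q ↔ {n : ℕ+ | {m : ℕ+ | n ^ (m : ℕ) ∈ A} ∈ q} ∈ p :=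
  Iff.rfl

/-- The set `ESW` of exponential Schur witnesses. -/
def ESW : Set BetaN :=
  {p | ∀ A ∈ p, ∃ x ∈ A, ∃ y ∈ A, x ^ (y : ℕ) ∈ A}

/-!
If `A ∈ E₁ p q`, then some `n` has `B = {m | n ^ m ∈ A} ∈ q`, and since
`(n ^ a) ^ (n ^ b) = n ^ (a * n ^ b)`, it is enough to find `a, b ∈ B` with `a * n ^ b ∈ B`. As
`{r | B ∈ r}` is a neighbourhood of `q`, one may assume `q ∈ K(β ℕ, ⊙)`.

Elements `q` of `K(β ℕ, ⊙)` are recurrent: every `w` satisfies `s * (w * q) = q` for some `s`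
(`exists_mul_mul_eq_of_mem_smallestIdeal`). By compactness, a finite set `F` has the property that every
`m` admits some `t ∈ F` with `t * (m * y) ∈ B` for `q`-almost all `y`
(`exists_finset_forall_eventually_mem`). The choice of `t` is a finite colouring of `ℕ+`, and it is used
twice (`exists_mul_pow_mem`).

* By Hindman's theorem there is a sequence `g` whose differences `g k - g j`, `j < k`, all have one
  colour `t`. Hence for any `r` some `y` satisfies `t * ((g k - g j) * y) ∈ B` for all `j < k ≤ r`.
* For `r = #F`, two of the `r + 1` numbers `n ^ (t * (g j * y))`, `j ≤ r`, have the same colour `t'`,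
  so for some `z` both `a = t' * (n ^ (t * (g j * y)) * z)` and `t' * (n ^ (t * (g k * y)) * z)` lie in
  `B`. The latter is `a * n ^ b` for `b = t * ((g k - g j) * y) ∈ B`.
-/

/-- A minimal closed left ideal consists of elements that can be recovered after multiplication on
the left by an arbitrary ultrafilter. -/
theorem exists_forall_exists_mul_mul_eq :
    ∃ q : BetaN, ∀ w : BetaN, ∃ s : BetaN, s * (w * q) = q := by
  obtain ⟨M, hM⟩ : ∃ M, Minimal
      (· ∈ {L : Set BetaN | IsClosed L ∧ L.Nonempty ∧ ∀ x ∈ L, ∀ s : BetaN, s * x ∈ L}) M := by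
    refine zorn_superset _ fun c hcs hc => ?_
    rcases c.eq_empty_or_nonempty with rfl | hne
    · exact ⟨Set.univ, ⟨isClosed_univ, ⟨pure 1, trivial⟩, fun _ _ _ => trivial⟩, by simp⟩
    · refine ⟨⋂₀ c, ⟨isClosed_sInter fun t ht => (hcs ht).1, ?_, fun x hx s t ht =>
        (hcs ht).2.2 x (hx t ht) s⟩, fun t ht => Set.sInter_subset_of_mem ht⟩
      have := hne.to_subtype
      rw [Set.sInter_eq_iInter]
      exact IsCompact.nonempty_iInter_of_directed_nonempty_isCompact_isClosed _
        (DirectedOn.directed_val (IsChain.directedOn hc.symm)) (fun t => (hcs t.2).2.1)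
        (fun t => (hcs t.2).1.isCompact) (fun t => (hcs t.2).1)
  obtain ⟨q, hq⟩ := hM.prop.2.1
  refine ⟨q, fun w => ?_⟩
  have hsub : M ⊆ Set.range (fun s : BetaN => s * (w * q)) := by
    refine hM.le_of_le ⟨?_, Set.range_nonempty _, ?_⟩ ?_
    · exact (isCompact_range (Ultrafilter.continuous_mul_left (w * q))).isClosed
    · rintro _ ⟨s, rfl⟩ t
      exact ⟨t * s, mul_assoc _ _ _⟩
    · rintro _ ⟨s, rfl⟩
      exact hM.prop.2.2 _ (hM.prop.2.2 q hq w) s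
  exact hsub hq

/-- The ultrafilters with the stated recurrence property form a two-sided ideal. -/
theorem exists_mul_mul_eq_of_mem_smallestIdeal {q : BetaN} (hq : q ∈ smallestIdeal BetaN)
    (w : BetaN) : ∃ s : BetaN, s * (w * q) = q := by
  have hI : IsTwoSidedIdeal {q : BetaN | ∀ w : BetaN, ∃ s : BetaN, s * (w * q) = q} := by
    refine ⟨exists_forall_exists_mul_mul_eq, fun x hx u => ⟨fun w => ?_, fun w => ?_⟩⟩
    · obtain ⟨s, hs⟩ := hx (w * u)
      exact ⟨u * s, by rw [mul_assoc, ← mul_assoc w, hs]⟩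
    · obtain ⟨s, hs⟩ := hx w
      exact ⟨s, by rw [← mul_assoc w, ← mul_assoc, hs]⟩
  exact hq _ hI w

/-- Members of an ultrafilter in `K(β ℕ, ⊙)` return syndetically. -/
theorem exists_finset_forall_eventually_mem {q : BetaN} (hq : q ∈ smallestIdeal BetaN)
    {B : Set ℕ+} (hB : B ∈ q) :
    ∃ F : Finset ℕ+, ∀ m : ℕ+, ∃ t ∈ F, ∀ᶠ y in (q : Filter ℕ+), t * (m * y) ∈ B := by
  let U : ℕ+ → Set BetaN := fun t => {w | {m | ∀ᶠ y in (q : Filter ℕ+), t * (m * y) ∈ B} ∈ w}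
  have hcover : (Set.univ : Set BetaN) ⊆ ⋃ t, U t := by
    intro w _
    obtain ⟨s, hs⟩ := exists_mul_mul_eq_of_mem_smallestIdeal hq w
    rw [← hs, BetaN.mem_mul] at hB
    obtain ⟨t, ht⟩ := Ultrafilter.nonempty_of_mem hB
    exact Set.mem_iUnion.2 ⟨t, ht⟩
  obtain ⟨F, hF⟩ := isCompact_univ.elim_finite_subcover U
    (fun _ => ultrafilter_isOpen_basic _) hcover
  refine ⟨F, fun m => ?_⟩
  obtain ⟨t, ht, hm⟩ := Set.mem_iUnion₂.1 (hF (Set.mem_univ (pure m)))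
  exact ⟨t, ht, hm⟩

/-- The differences of the sequence of partial sums of `a` are finite sums of `a`. -/
theorem exists_mem_FS_eq_add {a : Stream' ℕ+} {g : ℕ → ℕ+} (hg : ∀ j, g (j + 1) = g j + a.get j)
    (i j : ℕ) : ∃ m ∈ Hindman.FS (a.drop j), g (j + 1 + i) = g j + m := by
  induction i generalizing j with
  | zero => exact ⟨_, Hindman.FS.head _, by simpa using hg j⟩
  | succ i ih =>
    obtain ⟨m, hm, h⟩ := ih (j + 1)
    refine ⟨a.get j + m, ?_, ?_⟩
    · rw [← Stream'.head_drop]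
      refine Hindman.FS.cons _ _ ?_
      rwa [Stream'.tail_eq_drop, Stream'.drop_drop]
    · rw [← add_assoc (g j), ← hg, ← h]
      congr 1
      omega

/-- Every finite colouring of `ℕ+` admits a sequence all of whose differences have the same colour:
the partial sums of a sequence provided by Hindman's theorem. -/
theorem exists_seq_differences_monochromatic {F : Finset ℕ+} {c : ℕ+ → ℕ+} (hc : ∀ m, c m ∈ F) :
    ∃ t, ∃ g : ℕ → ℕ+, ∀ j k, j < k → ∃ m, c m = t ∧ g k = g j + m := by
  obtain ⟨_, ⟨t, -, rfl⟩, a, ha⟩ := Hindman.exists_FS_of_finite_cover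
    ((fun t => {m | c m = t}) '' (F : Set ℕ+)) (F.finite_toSet.image _)
    fun m _ => ⟨_, ⟨c m, hc m, rfl⟩, rfl⟩
  let g : ℕ → ℕ+ := fun j => Nat.rec 1 (fun i x => x + a.get i) j
  refine ⟨t, g, fun j k hjk => ?_⟩
  obtain ⟨i, rfl⟩ := Nat.exists_eq_add_of_le (Nat.succ_le_of_lt hjk)
  obtain ⟨m, hm, h⟩ := exists_mem_FS_eq_add (a := a) (g := g) (fun _ => rfl) i j
  exact ⟨m, ha (Hindman.FS_iter_tail_sub_FS a j hm), h⟩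

/-- Members of an ultrafilter in `K(β ℕ, ⊙)` contain exponential triples `a`, `b`, `a * n ^ b`. -/
theorem exists_mul_pow_mem {q : BetaN} (hq : q ∈ smallestIdeal BetaN) {B : Set ℕ+} (hB : B ∈ q)
    (n : ℕ+) : ∃ a ∈ B, ∃ b ∈ B, a * n ^ (b : ℕ) ∈ B := by
  obtain ⟨F, hF⟩ := exists_finset_forall_eventually_mem hq hB
  choose c hcF hc using hF
  obtain ⟨t, g, hg⟩ := exists_seq_differences_monochromatic hcF
  choose! d hdc hd using hg
  -- One dilation puts the finitely many differences of the first `#F + 1` terms into `B`.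
  obtain ⟨y, hy⟩ : ∃ y, ∀ k ∈ Finset.range (F.card + 1), ∀ j ∈ Finset.range k,
      t * (d j k * y) ∈ B := by
    refine Filter.Eventually.exists (f := (q : Filter ℕ+)) ?_
    simp only [Filter.eventually_all_finset]
    intro k _ j hj
    have := hc (d j k)
    rwa [hdc j k (Finset.mem_range.1 hj)] at this
  let x : ℕ → ℕ+ := fun j => n ^ ((t * (g j * y) : ℕ+) : ℕ)
  have hx : ∀ j k, j < k → x k = x j * n ^ ((t * (d j k * y) : ℕ+) : ℕ) := by
    intro j k hjk
    simp only [x]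
    rw [← pow_add, ← PNat.add_coe, ← mul_add, ← add_mul, ← hd j k hjk]
  obtain ⟨j, k, hjk, hk, hcol⟩ : ∃ j k, j < k ∧ k ∈ Finset.range (F.card + 1) ∧
      c (x j) = c (x k) := by
    obtain ⟨j, hj, k, hk, hne, hcol⟩ := Finset.exists_ne_map_eq_of_card_lt_of_maps_to
      (s := Finset.range (F.card + 1)) (t := F) (f := fun j => c (x j)) (by simp)
      (fun j _ => hcF _)
    rcases hne.lt_or_gt with h | h
    · exact ⟨j, k, h, hk, hcol⟩
    · exact ⟨k, j, h, hj, hcol.symm⟩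
  obtain ⟨z, hzj, hzk⟩ := ((hc (x j)).and (hc (x k))).exists
  refine ⟨_, hzj, _, hy k hk j (Finset.mem_range.2 hjk), ?_⟩
  rw [← hcol, hx j k hjk] at hzk
  convert hzk using 1
  ac_rfl

theorem mainTheorem6 (q : BetaN) (hq : q ∈ closure (smallestIdeal BetaN))
    (p : BetaN) (hp : p ≠ pure 1) : E₁ p q ∈ ESW := by
  intro A hA
  rw [mem_E₁] at hA
  obtain ⟨n, hn⟩ := Ultrafilter.nonempty_of_mem hA
  obtain ⟨q', hB, hq'⟩ := mem_closure_iff.1 hq _ (ultrafilter_isOpen_basic _) hn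
  obtain ⟨a, ha, b, hb, hab⟩ := exists_mul_pow_mem hq' hB n
  refine ⟨_, ha, _, hb, ?_⟩
  rw [← pow_mul]
  simpa using hab
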